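/- Let $\mu$ be a Borel probability measure on $\mathbb{C}$ with $\mu(\{|z|=1\})=1$, let $Z_1,Z_2,\dots$ be i.i.d. complex random variables with law $\mu$ on a probability space $(\Omega,\mathbb{P})$, and put $P_n(z)=(z-Z_1)\cdots(z-Z_n)$. Fix an integer $k>1$. For $n\ge k+1$ let $W^{(k)}_{n,1},\dots,W^{(k)}_{n,n-k}$ be the zeros, counted with multiplicity, of the $k$-th derivative $P_n^{(k)}$, and let $\mu^{(k)}_n=\frac{1}{n-k}\sum_{j=1}^{n-k}\delta_{W^{(k)}_{n,j}}$ be their empirical measure. If $\mu$ is not the uniform distribution on the unit circle, then, almost surely, $\mu^{(k)}_n$ converges weakly to $\mu$ as $n\to\infty$. -/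

import Mathlib

open MeasureTheory ProbabilityTheory Filter Topology Polynomial
open scoped ENNReal

noncomputable section

/-- The uniform probability measure on the unit circle, as a measure on `ℂ`: the image of the
normalised Lebesgue measure on `(0, 2π]` under `θ ↦ exp (i θ)`. -/
def uniformCircle : ProbabilityMeasure ℂ :=
  ⟨((ENNReal.ofReal (2 * Real.pi))⁻¹ •
      (volume.restrict (Set.Ioc (0 : ℝ) (2 * Real.pi)))).map
        (fun θ : ℝ => Complex.exp (θ * Complex.I)), by
    have hpi : 0 < 2 * Real.pi := by positivity
    have : IsProbabilityMeasure ((ENNReal.ofReal (2 * Real.pi))⁻¹ •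
        (volume.restrict (Set.Ioc (0 : ℝ) (2 * Real.pi)))) := by
      constructor
      simp only [Measure.smul_apply, Measure.restrict_apply_univ, Real.volume_Ioc, sub_zero,
        smul_eq_mul]
      exact ENNReal.inv_mul_cancel (by simpa using Real.pi_pos) ENNReal.ofReal_ne_top
    exact Measure.isProbabilityMeasure_map (by fun_prop)⟩

/-- The polynomial `(z - z₁) ⋯ (z - zₙ)` with the first `n` terms of a sequence as its zeros
(the sequence is indexed from `0`). -/
def polyOfZeros (z : ℕ → ℂ) (n : ℕ) : ℂ[X] :=
  ∏ j ∈ Finset.range n, (X - C (z j))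

/-- The zeros, with multiplicities, of the `k`-th derivative of `(z - z₁) ⋯ (z - zₙ)`. -/
def derivZeros (z : ℕ → ℂ) (k n : ℕ) : Multiset ℂ :=
  (derivative^[k] (polyOfZeros z n)).roots

theorem card_derivZeros (z : ℕ → ℂ) (k n : ℕ) :
    (derivZeros z k n).card = n - k := by
  have h : ∀ i, (derivative^[i] (polyOfZeros z n)).natDegree = n - i := by
    intro i
    induction i with
    | zero => simp [polyOfZeros]
    | succ i ih =>
      rw [Function.iterate_succ_apply', natDegree_derivative, ih]
      omega
  rw [derivZeros, IsAlgClosed.card_roots_eq_natDegree, h]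

/-- The empirical measure `(1 / N) ∑ δ_w` of a multiset of `N` points, counted with
multiplicities. -/
def empiricalMeasure (s : Multiset ℂ) : Measure ℂ :=
  (s.card : ℝ≥0∞)⁻¹ • (s.map Measure.dirac).sum

theorem isProbabilityMeasure_empiricalMeasure (s : Multiset ℂ) (hs : s.card ≠ 0) :
    IsProbabilityMeasure (empiricalMeasure s) := by
  have key : ∀ t : Multiset ℂ, (t.map Measure.dirac).sum Set.univ = (t.card : ℝ≥0∞) := by
    intro t
    induction t using Multiset.induction_on with
    | empty => simp
    | cons a t ih => simp [ih, add_comm]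
  constructor
  rw [empiricalMeasure, Measure.smul_apply, key, smul_eq_mul]
  exact ENNReal.inv_mul_cancel (by exact_mod_cast hs) (ENNReal.natCast_ne_top _)

/-- The empirical measure of the `n - k` zeros of the `k`-th derivative of
`(z - z₁) ⋯ (z - zₙ)`, for `n ≥ k + 1`, as a probability measure on `ℂ`. -/
def derivZerosMeasure (z : ℕ → ℂ) (k n : ℕ) (hn : k + 1 ≤ n) : ProbabilityMeasure ℂ :=
  ⟨empiricalMeasure (derivZeros z k n),
    isProbabilityMeasure_empiricalMeasure _ (by rw [card_derivZeros]; omega)⟩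

end

/-! Fix a realisation, with all `z j` on the unit circle, and put `q = P_n^(k)`. By Gauss–Lucas its
zeros stay in the closed disc, and two facts determine their limit.

Outside the disc, passing from a polynomial to its derivative changes the logarithmic derivative by
`O(1)`: the change is `(p'/p)' / (p'/p)`, whose numerator is at most, and whose denominator is at
least, of the order of the degree (`norm_eval_derivative_div_eval_sub_le`). After division by the
degree, `q'/q` and `P_n'/P_n` have the same limit, which the strong law identifies as the Cauchy
transform of `μ`.

This alone fixes only holomorphic moments, so the zeros must also be shown to approach the circle.
Choose `w ≠ 0` in the open disc where the Cauchy transform `c` of `μ` is nonzero. Then `q w / (n^k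
P_n w)` tends to `c^k` (`tendsto_normalizedDeriv`), while at the reflected point `u = 1 / conj w`
one has `|q u| ≤ C n^k |P_n u|`, and `|P_n w| = |w|^n |P_n u|`. A Jensen-type inequality
(`sum_roots_one_sub_normSq_le`) turns this into a bound, uniform in `n`, for the sum of `1 - |a|^2`
over the zeros of `q`; its average tends to `0`. Stone–Weierstrass then gives weak convergence
(`tendsto_of_tendsto_cauchyTransform`).

Non-uniformity enters only through the existence of `w` (`exists_integral_one_div_sub_ne_zero`). -/

/-! ### Weak convergence on the disc from Cauchy transforms -/

/-- A bounded measurable test function on the closed unit disc along which the integrals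
against `ν i` converge to the integral against `μ`. -/
structure IntegralsConverge {ι : Type*} (l : Filter ι) (ν : ι → ProbabilityMeasure ℂ)
    (μ : ProbabilityMeasure ℂ) (f : ℂ → ℂ) : Prop where
  bdd : ∃ C, ∀ z, ‖z‖ ≤ 1 → ‖f z‖ ≤ C
  meas : Measurable f
  tendsto : Tendsto (fun i => ∫ z, f z ∂(ν i : Measure ℂ)) l (𝓝 (∫ z, f z ∂(μ : Measure ℂ)))

theorem integrable_of_bounded_on_disc {ρ : Measure ℂ} [IsFiniteMeasure ρ]
    (hρ : ∀ᵐ z ∂ρ, ‖z‖ ≤ 1) {f : ℂ → ℂ} (hb : ∃ C, ∀ z, ‖z‖ ≤ 1 → ‖f z‖ ≤ C)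
    (hm : Measurable f) : Integrable f ρ := by
  obtain ⟨C, hC⟩ := hb
  exact Integrable.of_bound hm.aestronglyMeasurable C (hρ.mono fun z hz => hC z hz)

section
variable {ι : Type*} {l : Filter ι} {ν : ι → ProbabilityMeasure ℂ} {μ : ProbabilityMeasure ℂ}

theorem IntegralsConverge.add {f g : ℂ → ℂ} (hν : ∀ i, ∀ᵐ z ∂(ν i : Measure ℂ), ‖z‖ ≤ 1)
    (hμ : ∀ᵐ z ∂(μ : Measure ℂ), ‖z‖ ≤ 1)
    (hf : IntegralsConverge l ν μ f) (hg : IntegralsConverge l ν μ g) :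
    IntegralsConverge l ν μ (fun z => f z + g z) where
  bdd := by
    obtain ⟨C, hC⟩ := hf.bdd
    obtain ⟨D, hD⟩ := hg.bdd
    exact ⟨C + D, fun z hz => (norm_add_le _ _).trans (add_le_add (hC z hz) (hD z hz))⟩
  meas := hf.meas.add hg.meas
  tendsto := by
    have h : ∀ ρ : ProbabilityMeasure ℂ, (∀ᵐ z ∂(ρ : Measure ℂ), ‖z‖ ≤ 1) →
        ∫ z, (f z + g z) ∂(ρ : Measure ℂ)
          = ∫ z, f z ∂(ρ : Measure ℂ) + ∫ z, g z ∂(ρ : Measure ℂ) := fun ρ hρ =>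
      integral_add (integrable_of_bounded_on_disc hρ hf.bdd hf.meas)
        (integrable_of_bounded_on_disc hρ hg.bdd hg.meas)
    rw [h μ hμ]
    simp_rw [fun i => h (ν i) (hν i)]
    exact hf.tendsto.add hg.tendsto

theorem IntegralsConverge.const_mul {f : ℂ → ℂ} (c : ℂ) (hf : IntegralsConverge l ν μ f) :
    IntegralsConverge l ν μ (fun z => c * f z) where
  bdd := by
    obtain ⟨C, hC⟩ := hf.bdd
    exact ⟨‖c‖ * C, fun z hz => by rw [norm_mul]; gcongr; exact hC z hz⟩
  meas := hf.meas.const_mul c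
  tendsto := by
    simp_rw [integral_const_mul]
    exact hf.tendsto.const_mul c

theorem IntegralsConverge.conj {f : ℂ → ℂ} (hf : IntegralsConverge l ν μ f) :
    IntegralsConverge l ν μ (fun z => starRingEnd ℂ (f z)) where
  bdd := by simpa using hf.bdd
  meas := Complex.continuous_conj.measurable.comp hf.meas
  tendsto := by
    simp_rw [integral_conj]
    exact (Complex.continuous_conj.tendsto _).comp hf.tendsto

theorem IntegralsConverge.of_uniform_approx {f : ℂ → ℂ}
    (hν : ∀ i, ∀ᵐ z ∂(ν i : Measure ℂ), ‖z‖ ≤ 1) (hμ : ∀ᵐ z ∂(μ : Measure ℂ), ‖z‖ ≤ 1)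
    (hm : Measurable f)
    (h : ∀ ε > 0, ∃ g, IntegralsConverge l ν μ g ∧ ∀ z, ‖z‖ ≤ 1 → ‖f z - g z‖ ≤ ε) :
    IntegralsConverge l ν μ f := by
  have hb : ∃ C, ∀ z, ‖z‖ ≤ 1 → ‖f z‖ ≤ C := by
    obtain ⟨g, hg, hfg⟩ := h 1 one_pos
    obtain ⟨C, hC⟩ := hg.bdd
    refine ⟨1 + C, fun z hz => ?_⟩
    calc ‖f z‖ = ‖(f z - g z) + g z‖ := by ring_nf
      _ ≤ _ := (norm_add_le _ _).trans (add_le_add (hfg z hz) (hC z hz))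
  refine ⟨hb, hm, ?_⟩
  rw [Metric.tendsto_nhds]
  intro ε hε
  obtain ⟨g, hg, hfg⟩ := h (ε / 3) (by positivity)
  have key : ∀ ρ : ProbabilityMeasure ℂ, (∀ᵐ z ∂(ρ : Measure ℂ), ‖z‖ ≤ 1) →
      dist (∫ z, f z ∂(ρ : Measure ℂ)) (∫ z, g z ∂(ρ : Measure ℂ)) ≤ ε / 3 := fun ρ hρ => by
    rw [dist_eq_norm, ← integral_sub (integrable_of_bounded_on_disc hρ hb hm)
      (integrable_of_bounded_on_disc hρ hg.bdd hg.meas)]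
    simpa using norm_integral_le_of_norm_le_const (hρ.mono fun z hz => hfg z hz)
  filter_upwards [(Metric.tendsto_nhds.1 hg.tendsto) (ε / 3) (by positivity)] with i hi
  have h1 := key (ν i) (hν i)
  have h2 := key μ hμ
  rw [dist_comm] at h2
  have := dist_triangle4 (∫ z, f z ∂(ν i : Measure ℂ)) (∫ z, g z ∂(ν i : Measure ℂ))
    (∫ z, g z ∂(μ : Measure ℂ)) (∫ z, f z ∂(μ : Measure ℂ))
  linarith

theorem norm_natCast_add_two (j : ℕ) : ‖((j : ℂ) + 2)‖ = j + 2 := by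
  have : ((j : ℂ) + 2) = ((j + 2 : ℕ) : ℂ) := by push_cast; ring
  rw [this, Complex.norm_natCast]
  push_cast
  ring

theorem one_le_norm_sub_of_norm_le_one {z : ℂ} (hz : ‖z‖ ≤ 1) (j : ℕ) :
    (j : ℝ) + 1 ≤ ‖((j : ℂ) + 2) - z‖ := by
  have h := norm_sub_norm_le ((j : ℂ) + 2) z
  rw [norm_natCast_add_two] at h
  linarith

/-- With `x = j + 2`, the identity `z^(m+1)/(x-z) = x z^m/(x-z) - z^m` raises the power in the
numerator, and `x z^m/(x-z)` tends to `z^m` uniformly on the disc as `x` grows. The two facts feed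
each other by induction on `m`. -/
theorem integralsConverge_pow (hν : ∀ i, ∀ᵐ z ∂(ν i : Measure ℂ), ‖z‖ ≤ 1)
    (hμ : ∀ᵐ z ∂(μ : Measure ℂ), ‖z‖ ≤ 1)
    (h : ∀ j : ℕ, IntegralsConverge l ν μ (fun z => 1 / ((j : ℂ) + 2 - z))) (m : ℕ) :
    IntegralsConverge l ν μ (fun z => z ^ m) := by
  have step : ∀ m : ℕ, (∀ j : ℕ, IntegralsConverge l ν μ (fun z => z ^ m / ((j : ℂ) + 2 - z))) →
      IntegralsConverge l ν μ (fun z => z ^ m) := by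
    intro m hm
    refine IntegralsConverge.of_uniform_approx hν hμ (by fun_prop) fun ε hε => ?_
    -- The error is `z^(m+1)/(x-z)`, of norm at most `1/(j+1)`, hence below `ε`.
    obtain ⟨j, hj⟩ := exists_nat_gt (1 / ε)
    refine ⟨_, (hm j).const_mul ((j : ℂ) + 2), fun z hz => ?_⟩
    have h1 := one_le_norm_sub_of_norm_le_one hz j
    have h0 : 0 < ‖((j : ℂ) + 2) - z‖ := lt_of_lt_of_le (by positivity) ‹(j : ℝ) + 1 ≤ _›
    have hne : ((j : ℂ) + 2) - z ≠ 0 := norm_pos_iff.1 h0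
    have : z ^ m - ((j : ℂ) + 2) * (z ^ m / ((j : ℂ) + 2 - z))
        = - (z ^ (m + 1) / ((j : ℂ) + 2 - z)) := by
      field_simp
      ring
    rw [this, norm_neg, norm_div, norm_pow, div_le_iff₀ h0]
    have h2 : ‖z‖ ^ (m + 1) ≤ 1 := pow_le_one₀ (norm_nonneg _) hz
    have h3 : 1 < j * ε := by rwa [div_lt_iff₀ hε] at hj
    nlinarith
  have all : ∀ m j : ℕ, IntegralsConverge l ν μ (fun z => z ^ m / ((j : ℂ) + 2 - z)) := by
    intro m
    induction m with
    | zero => simpa using h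
    | succ m ih =>
      intro j
      have h1 := ((ih j).const_mul ((j : ℂ) + 2)).add hν hμ ((step m ih).const_mul (-1))
      refine IntegralsConverge.of_uniform_approx hν hμ (by fun_prop) fun ε hε =>
        ⟨_, h1, fun z hz => ?_⟩
      have h2 := one_le_norm_sub_of_norm_le_one hz j
      have hne : ((j : ℂ) + 2) - z ≠ 0 := norm_pos_iff.1 (lt_of_lt_of_le (by positivity) ‹(j : ℝ) + 1 ≤ _›)
      have : z ^ (m + 1) / ((j : ℂ) + 2 - z)
        - (((j : ℂ) + 2) * (z ^ m / ((j : ℂ) + 2 - z)) + -1 * z ^ m) = 0 := by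
        field_simp
        ring
      rw [this, norm_zero]
      exact hε.le
  exact step m (all m)

/-- Allows a test function to be replaced by one that agrees with it on the circle, once the mass
has moved there. -/
theorem IntegralsConverge.of_tendsto_integral_norm_sub {f g : ℂ → ℂ}
    (hν : ∀ i, ∀ᵐ z ∂(ν i : Measure ℂ), ‖z‖ ≤ 1)
    (hb : ∃ C, ∀ z, ‖z‖ ≤ 1 → ‖f z‖ ≤ C) (hm : Measurable f) (hg : IntegralsConverge l ν μ g)
    (hfg : ∀ᵐ z ∂(μ : Measure ℂ), f z = g z)
    (h : Tendsto (fun i => ∫ z, ‖f z - g z‖ ∂(ν i : Measure ℂ)) l (𝓝 0)) :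
    IntegralsConverge l ν μ f := by
  refine ⟨hb, hm, ?_⟩
  rw [integral_congr_ae hfg]
  have : Tendsto (fun i => ∫ z, (f z - g z) ∂(ν i : Measure ℂ)) l (𝓝 0) :=
    squeeze_zero_norm (fun i => norm_integral_le_integral_norm _) h
  have := this.add hg.tendsto
  rw [zero_add] at this
  refine this.congr fun i => ?_
  rw [integral_sub (integrable_of_bounded_on_disc (hν i) hb hm)
    (integrable_of_bounded_on_disc (hν i) hg.bdd hg.meas), sub_add_cancel]

/-- Since `z * conj z = |z|^2`, the difference is `z^a ((|z|^2)^b - 1)`, and Bernoulli's inequality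
applies. -/
theorem norm_pow_mul_conj_pow_sub_le {z : ℂ} (hz : ‖z‖ ≤ 1) (a b : ℕ) :
    ‖z ^ (a + b) * (starRingEnd ℂ z) ^ b - z ^ a‖ ≤ b * (1 - ‖z‖ ^ 2) := by
  have h : z ^ (a + b) * (starRingEnd ℂ z) ^ b - z ^ a
      = z ^ a * (((‖z‖ ^ 2) ^ b - 1 : ℝ) : ℂ) := by
    have : z * starRingEnd ℂ z = ((‖z‖ ^ 2 : ℝ) : ℂ) := by
      rw [Complex.mul_conj, Complex.normSq_eq_norm_sq]
    rw [pow_add, mul_assoc, ← mul_pow, this]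
    push_cast; ring
  have h1 : (‖z‖ ^ 2) ^ b ≤ 1 := pow_le_one₀ (by positivity) (pow_le_one₀ (norm_nonneg _) hz)
  have h2 := one_add_mul_le_pow (a := ‖z‖ ^ 2 - 1) (by nlinarith [sq_nonneg ‖z‖]) b
  rw [add_sub_cancel] at h2
  rw [h, norm_mul, norm_pow, Complex.norm_real, Real.norm_eq_abs, abs_of_nonpos (by linarith)]
  have h3 : ‖z‖ ^ a ≤ 1 := pow_le_one₀ (norm_nonneg _) hz
  nlinarith [norm_nonneg z]

theorem integralsConverge_monomial (hν : ∀ i, ∀ᵐ z ∂(ν i : Measure ℂ), ‖z‖ ≤ 1)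
    (hμ : ∀ᵐ z ∂(μ : Measure ℂ), ‖z‖ = 1)
    (hr : Tendsto (fun i => ∫ z, (1 - ‖z‖ ^ 2) ∂(ν i : Measure ℂ)) l (𝓝 0))
    (h : ∀ j : ℕ, IntegralsConverge l ν μ (fun z => 1 / ((j : ℂ) + 2 - z))) (a b : ℕ) :
    IntegralsConverge l ν μ (fun z => z ^ a * (starRingEnd ℂ z) ^ b) := by
  have hμ' : ∀ᵐ z ∂(μ : Measure ℂ), ‖z‖ ≤ 1 := hμ.mono fun z hz => hz.le
  have main : ∀ a b : ℕ,
      IntegralsConverge l ν μ (fun z => z ^ (a + b) * (starRingEnd ℂ z) ^ b) := by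
    intro a b
    have hmeas : Measurable fun z : ℂ => z ^ (a + b) * (starRingEnd ℂ z) ^ b :=
      (by fun_prop : Continuous fun z : ℂ => z ^ (a + b) * (starRingEnd ℂ z) ^ b).measurable
    refine IntegralsConverge.of_tendsto_integral_norm_sub hν ⟨1, fun z hz => ?_⟩ hmeas
      (integralsConverge_pow hν hμ' h a) ?_ ?_
    · rw [norm_mul, norm_pow, norm_pow, RCLike.norm_conj]
      exact mul_le_one₀ (pow_le_one₀ (norm_nonneg _) hz) (by positivity)
        (pow_le_one₀ (norm_nonneg _) hz)
    · filter_upwards [hμ] with z hz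
      have := norm_pow_mul_conj_pow_sub_le hz.le a b
      rw [hz] at this
      rw [← sub_eq_zero, ← norm_le_zero_iff]
      simpa using this
    · have hr' := hr.const_mul (b : ℝ)
      rw [mul_zero] at hr'
      refine squeeze_zero (fun i => integral_nonneg fun z => norm_nonneg _) (fun i => ?_) hr'
      rw [← integral_const_mul]
      have hi : Integrable (fun z : ℂ => (b : ℝ) * (1 - ‖z‖ ^ 2)) (ν i : Measure ℂ) := by
        refine Integrable.of_bound (by fun_prop) (b : ℝ) ((hν i).mono fun z hz => ?_)
        have : ‖z‖ ^ 2 ≤ 1 := pow_le_one₀ (norm_nonneg _) hz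
        rw [norm_mul, Real.norm_eq_abs, Real.norm_eq_abs, Nat.abs_cast]
        refine mul_le_of_le_one_right (by positivity) ?_
        rw [abs_of_nonneg (by linarith)]
        linarith [sq_nonneg ‖z‖]
      exact integral_mono_of_nonneg (ae_of_all _ fun z => norm_nonneg _) hi
        ((hν i).mono fun z hz => norm_pow_mul_conj_pow_sub_le hz a b)
  -- `main` covers exponents with `b ≤ a`; conjugation gives the others.
  rcases le_total b a with hab | hab
  · obtain ⟨c, rfl⟩ := Nat.exists_eq_add_of_le hab
    rw [add_comm b c]
    exact main c b
  · obtain ⟨c, rfl⟩ := Nat.exists_eq_add_of_le hab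
    have := (main c a).conj
    simp only [map_mul, map_pow, Complex.conj_conj] at this
    rw [add_comm a c]
    simpa only [mul_comm] using this

theorem integralsConverge_of_mem_adjoin (hν : ∀ i, ∀ᵐ z ∂(ν i : Measure ℂ), ‖z‖ ≤ 1)
    (hμ : ∀ᵐ z ∂(μ : Measure ℂ), ‖z‖ ≤ 1)
    (h : ∀ a b : ℕ, IntegralsConverge l ν μ (fun z => z ^ a * (starRingEnd ℂ z) ^ b))
    {f : ℂ → ℂ} (hf : f ∈ Algebra.adjoin ℂ ({id, ⇑(starRingEnd ℂ)} : Set (ℂ → ℂ))) :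
    IntegralsConverge l ν μ f := by
  rw [← Subalgebra.mem_toSubmodule, Algebra.adjoin_eq_span] at hf
  induction hf using Submodule.span_induction with
  | mem f hf =>
    obtain ⟨a, b, rfl⟩ := (Submonoid.mem_closure_pair _ _ _).1 hf
    exact h a b
  | zero =>
    have := (h 0 0).const_mul 0
    simp only [zero_mul] at this
    exact this
  | add f g _ _ hf hg => exact hf.add hν hμ hg
  | smul c f _ hf => exact hf.const_mul c

/-- Stone–Weierstrass on the compact disc; the approximant is then lifted from the disc to a
function on all of `ℂ`. -/
theorem exists_mem_adjoin_approx {f : ℂ → ℂ} (hf : Continuous f) {ε : ℝ} (hε : 0 < ε) :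
    ∃ g ∈ Algebra.adjoin ℂ ({id, ⇑(starRingEnd ℂ)} : Set (ℂ → ℂ)),
      ∀ z, ‖z‖ ≤ 1 → ‖f z - g z‖ ≤ ε := by
  set D : Set ℂ := Metric.closedBall 0 1
  have : CompactSpace D := isCompact_iff_compactSpace.1 (isCompact_closedBall 0 1)
  let F : C(D, ℂ) := ⟨fun z => f z, by fun_prop⟩
  have hF : F ∈ closure ((polynomialFunctions D).starClosure : Set C(D, ℂ)) := by
    rw [← StarSubalgebra.topologicalClosure_coe, polynomialFunctions.starClosure_topologicalClosure]
    trivial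
  obtain ⟨G, hG, hFG⟩ := Metric.mem_closure_iff.1 hF ε hε
  have rep : ∃ g ∈ Algebra.adjoin ℂ ({id, ⇑(starRingEnd ℂ)} : Set (ℂ → ℂ)),
      ∀ z : D, G z = g z := by
    rw [polynomialFunctions.starClosure_eq_adjoin_X] at hG
    replace hG : G ∈ Algebra.adjoin ℂ _ := hG
    clear hFG
    induction hG using Algebra.adjoin_induction with
    | mem x hx =>
      rcases hx with hx | hx
      · refine ⟨id, Algebra.subset_adjoin (by simp), fun z => ?_⟩
        rw [Set.mem_singleton_iff.1 hx]
        simp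
      · refine ⟨starRingEnd ℂ, Algebra.subset_adjoin (by simp), fun z => ?_⟩
        have : x = star (toContinuousMapOnAlgHom D X) := by
          rw [← Set.mem_singleton_iff.1 (Set.mem_star.1 hx), star_star]
        rw [this]
        simp
    | algebraMap r => exact ⟨algebraMap ℂ _ r, Subalgebra.algebraMap_mem _ _, fun z => rfl⟩
    | add x y _ _ hx hy =>
      obtain ⟨g, hg, hxg⟩ := hx
      obtain ⟨g', hg', hxg'⟩ := hy
      exact ⟨g + g', add_mem hg hg', fun z => by simp [hxg, hxg']⟩
    | mul x y _ _ hx hy =>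
      obtain ⟨g, hg, hxg⟩ := hx
      obtain ⟨g', hg', hxg'⟩ := hy
      exact ⟨g * g', mul_mem hg hg', fun z => by simp [hxg, hxg']⟩
  obtain ⟨g, hg, hGg⟩ := rep
  refine ⟨g, hg, fun z hz => ?_⟩
  have hzD : z ∈ D := by simpa [D] using hz
  rw [← hGg ⟨z, hzD⟩, ← dist_eq_norm]
  exact (ContinuousMap.dist_apply_le_dist (f := F) (g := G) ⟨z, hzD⟩).trans hFG.le

/-- Probability measures on the closed unit disc whose mass moves to the unit circle converge
weakly to a probability measure on the circle as soon as their Cauchy transforms converge along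
a sequence of points that tends to infinity. -/
theorem tendsto_of_tendsto_cauchyTransform (hν : ∀ i, ∀ᵐ z ∂(ν i : Measure ℂ), ‖z‖ ≤ 1)
    (hμ : ∀ᵐ z ∂(μ : Measure ℂ), ‖z‖ = 1)
    (hr : Tendsto (fun i => ∫ z, (1 - ‖z‖ ^ 2) ∂(ν i : Measure ℂ)) l (𝓝 0))
    (h : ∀ j : ℕ, Tendsto (fun i => ∫ z, 1 / ((j : ℂ) + 2 - z) ∂(ν i : Measure ℂ)) l
      (𝓝 (∫ z, 1 / ((j : ℂ) + 2 - z) ∂(μ : Measure ℂ)))) :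
    Tendsto ν l (𝓝 μ) := by
  have hμ' : ∀ᵐ z ∂(μ : Measure ℂ), ‖z‖ ≤ 1 := hμ.mono fun z hz => hz.le
  have h' : ∀ j : ℕ, IntegralsConverge l ν μ (fun z => 1 / ((j : ℂ) + 2 - z)) := fun j =>
    ⟨⟨1, fun z hz => by
      have := one_le_norm_sub_of_norm_le_one hz j
      have hj : (0 : ℝ) ≤ j := j.cast_nonneg
      rw [norm_div, norm_one, div_le_one (by linarith)]
      linarith⟩, by fun_prop, h j⟩
  rw [ProbabilityMeasure.tendsto_iff_forall_integral_rclike_tendsto ℂ]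
  intro f
  refine (IntegralsConverge.of_uniform_approx (f := f) hν hμ' f.continuous.measurable
    fun ε hε => ?_).tendsto
  obtain ⟨g, hg, hfg⟩ := exists_mem_adjoin_approx f.continuous hε
  exact ⟨g, integralsConverge_of_mem_adjoin hν hμ' (integralsConverge_monomial hν hμ hr h') hg,
    hfg⟩

end

/-! ### Roots in the closed disc: logarithmic derivatives outside it -/

theorem Multiset.norm_sum_map_le_card_mul (s : Multiset ℂ) (f : ℂ → ℂ) (C : ℝ)
    (h : ∀ a ∈ s, ‖f a‖ ≤ C) : ‖(s.map f).sum‖ ≤ s.card * C := by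
  induction s using Multiset.induction_on with
  | empty => simp
  | cons a s ih =>
    have h1 := h a (by simp)
    have h2 := ih fun b hb => h b (by simp [hb])
    rw [Multiset.map_cons, Multiset.sum_cons, Multiset.card_cons]
    push_cast
    linarith [norm_add_le (f a) (s.map f).sum]

theorem Multiset.card_mul_le_re_sum_map (s : Multiset ℂ) (f : ℂ → ℂ) (c : ℝ)
    (h : ∀ a ∈ s, c ≤ (f a).re) : s.card * c ≤ (s.map f).sum.re := by
  induction s using Multiset.induction_on with
  | empty => simp
  | cons a s ih =>
    have h1 := h a (by simp)
    have h2 := ih fun b hb => h b (by simp [hb])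
    rw [Multiset.map_cons, Multiset.sum_cons, Multiset.card_cons, Complex.add_re]
    push_cast
    linarith

namespace Polynomial

variable {p : ℂ[X]} {z : ℂ}

theorem norm_le_one_of_mem_roots_derivative (hp : ∀ a ∈ p.roots, ‖a‖ ≤ 1) {w : ℂ}
    (hw : w ∈ (derivative p).roots) : ‖w‖ ≤ 1 := by
  have hp' : derivative p ≠ 0 := ne_zero_of_mem_roots hw
  have hdeg : 0 < p.degree := by
    rw [← natDegree_pos_iff_degree_pos, Nat.pos_iff_ne_zero]
    exact fun h => hp' (derivative_of_natDegree_zero h)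
  have h1 := rootSet_derivative_subset_convexHull_rootSet hdeg
    (show w ∈ (derivative p).rootSet ℂ by
      rw [mem_rootSet]; exact ⟨hp', by simpa using isRoot_of_mem_roots hw⟩)
  have h2 : convexHull ℝ (p.rootSet ℂ) ⊆ Metric.closedBall (0 : ℂ) 1 := by
    refine convexHull_min (fun a ha => ?_) (convex_closedBall 0 1)
    rw [mem_rootSet] at ha
    simpa using hp a ((mem_roots ha.1).2 (by simpa using ha.2))
  simpa using h2 h1

theorem norm_le_one_of_mem_roots_iterate_derivative (hp : ∀ a ∈ p.roots, ‖a‖ ≤ 1) (k : ℕ) :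
    ∀ w ∈ (derivative^[k] p).roots, ‖w‖ ≤ 1 := by
  induction k with
  | zero => simpa using hp
  | succ k ih =>
    rw [Function.iterate_succ_apply']
    exact fun w hw => norm_le_one_of_mem_roots_derivative ih hw

theorem eval_ne_zero_of_one_lt_norm (h0 : p ≠ 0) (hp : ∀ a ∈ p.roots, ‖a‖ ≤ 1)
    (hz : 1 < ‖z‖) : p.eval z ≠ 0 :=
  fun h => hz.not_ge (hp z ((mem_roots h0).2 h))

theorem norm_one_div_sub_le {a : ℂ} (ha : ‖a‖ ≤ 1) (hz : 1 < ‖z‖) :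
    ‖1 / (z - a)‖ ≤ 1 / (‖z‖ - 1) := by
  rw [norm_div, norm_one]
  have := norm_sub_norm_le z a
  exact one_div_le_one_div_of_le (by linarith) (by linarith)

theorem eval_derivative_div_eval (hz : p.eval z ≠ 0) :
    (derivative p).eval z / p.eval z = (p.roots.map fun a => 1 / (z - a)).sum :=
  (IsAlgClosed.splits p).eval_derivative_div_eval_of_ne_zero hz

theorem card_roots_complex (p : ℂ[X]) : p.roots.card = p.natDegree :=
  IsAlgClosed.card_roots_eq_natDegree

theorem norm_eval_derivative_div_eval_le (h0 : p ≠ 0) (hp : ∀ a ∈ p.roots, ‖a‖ ≤ 1)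
    (hz : 1 < ‖z‖) :
    ‖(derivative p).eval z / p.eval z‖ ≤ p.natDegree / (‖z‖ - 1) := by
  rw [eval_derivative_div_eval (eval_ne_zero_of_one_lt_norm h0 hp hz), ← card_roots_complex,
    div_eq_mul_one_div]
  exact Multiset.norm_sum_map_le_card_mul _ _ _ fun a ha => norm_one_div_sub_le (hp a ha) hz

/-- Each term of `z p'/p = ∑ z/(z-a)` has real part at least `1/2`, because `|a| ≤ |z|`; hence there
is no cancellation. -/
theorem le_norm_eval_derivative_div_eval (h0 : p ≠ 0) (hp : ∀ a ∈ p.roots, ‖a‖ ≤ 1)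
    (hz : 1 < ‖z‖) :
    p.natDegree / (2 * ‖z‖) ≤ ‖(derivative p).eval z / p.eval z‖ := by
  rw [eval_derivative_div_eval (eval_ne_zero_of_one_lt_norm h0 hp hz), ← card_roots_complex]
  have h1 : p.roots.card * (1 / 2 : ℝ) ≤ (p.roots.map fun a => z * (1 / (z - a))).sum.re := by
    refine Multiset.card_mul_le_re_sum_map _ _ _ fun a ha => ?_
    have ha1 := hp a ha
    have hne : z - a ≠ 0 := fun h => by
      rw [sub_eq_zero.1 h] at hz; linarith
    have hpos : 0 < Complex.normSq (z - a) := Complex.normSq_pos.2 hne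
    have hre : (z * (1 / (z - a))).re = (z * starRingEnd ℂ (z - a)).re / Complex.normSq (z - a) := by
      rw [one_div, Complex.inv_def, ← mul_assoc, Complex.re_mul_ofReal, div_eq_mul_inv]
    rw [hre, le_div_iff₀ hpos]
    have e1 : z.re ^ 2 + z.im ^ 2 = ‖z‖ ^ 2 := by
      rw [← Complex.normSq_eq_norm_sq, Complex.normSq_apply]; ring
    have e2 : a.re ^ 2 + a.im ^ 2 = ‖a‖ ^ 2 := by
      rw [← Complex.normSq_eq_norm_sq, Complex.normSq_apply]; ring
    have e3 : ‖a‖ ^ 2 ≤ ‖z‖ ^ 2 := by gcongr; linarith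
    simp only [Complex.normSq_apply, Complex.mul_re, Complex.conj_re, Complex.conj_im,
      Complex.sub_re, Complex.sub_im]
    nlinarith
  rw [Multiset.sum_map_mul_left] at h1
  have h2 := (Complex.re_le_norm _).trans_eq
    (norm_mul z (p.roots.map fun a => 1 / (z - a)).sum)
  rw [div_le_iff₀ (by linarith)]
  linarith

theorem hasDerivAt_sum_one_div_sub (s : Multiset ℂ) (hs : ∀ a ∈ s, z ≠ a) :
    HasDerivAt (fun x => (s.map fun a => 1 / (x - a)).sum)
      (s.map fun a => -(1 / (z - a)) ^ 2).sum z := by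
  induction s using Multiset.induction_on with
  | empty => simpa using hasDerivAt_const z (0 : ℂ)
  | cons a s ih =>
    have h2 := ih fun b hb => hs b (by simp [hb])
    have hne : z - a ≠ 0 := sub_ne_zero.2 (hs a (by simp))
    have h1 : HasDerivAt (fun x : ℂ => 1 / (x - a)) (-(1 / (z - a)) ^ 2) z := by
      have := ((hasDerivAt_id z).sub_const a).inv hne
      simp only [id, one_div] at this ⊢
      convert! this using 1
      field_simp
    simp only [Multiset.map_cons, Multiset.sum_cons]
    exact h1.add h2

theorem norm_eval_derivative_div_eval_sub_le (h0 : 0 < p.natDegree) (hp : ∀ a ∈ p.roots, ‖a‖ ≤ 1)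
    (hz : 1 < ‖z‖) :
    ‖(derivative (derivative p)).eval z / (derivative p).eval z
      - (derivative p).eval z / p.eval z‖ ≤ 2 * ‖z‖ / (‖z‖ - 1) ^ 2 := by
  have hp0 : p ≠ 0 := by rintro rfl; simp at h0
  have hpz := eval_ne_zero_of_one_lt_norm hp0 hp hz
  have hlow := le_norm_eval_derivative_div_eval hp0 hp hz
  have hn : (0 : ℝ) < p.natDegree := by exact_mod_cast h0
  have hzpos : 0 < ‖z‖ - 1 := by linarith
  have hFpos : 0 < ‖(derivative p).eval z / p.eval z‖ :=
    lt_of_lt_of_le (div_pos hn (by linarith)) hlow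
  have hp'z : (derivative p).eval z ≠ 0 := fun h => by simp [h] at hFpos
  have hd1 : HasDerivAt (fun x => (derivative p).eval x / p.eval x)
      (((derivative (derivative p)).eval z * p.eval z
        - (derivative p).eval z * (derivative p).eval z) / (p.eval z) ^ 2) z :=
    ((derivative p).hasDerivAt z).div (p.hasDerivAt z) hpz
  have hd2 := hasDerivAt_sum_one_div_sub (z := z) p.roots fun a ha h => by
    have := hp a ha; rw [← h] at this; linarith
  have heq : (fun x => (derivative p).eval x / p.eval x)
      =ᶠ[𝓝 z] fun x => (p.roots.map fun a => 1 / (x - a)).sum := by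
    filter_upwards [p.continuous.continuousAt.eventually_ne hpz] with x hx
    exact eval_derivative_div_eval hx
  have hE := (hd2.congr_of_eventuallyEq heq).unique hd1
  have hS : ‖(p.roots.map fun a => -(1 / (z - a)) ^ 2).sum‖
      ≤ p.natDegree * (1 / (‖z‖ - 1)) ^ 2 := by
    rw [← card_roots_complex]
    refine Multiset.norm_sum_map_le_card_mul _ _ _ fun a ha => ?_
    rw [norm_neg, norm_pow]
    gcongr
    exact norm_one_div_sub_le (hp a ha) hz
  -- This is `(p'/p)' / (p'/p)`; the bound is `n/(|z|-1)^2` divided by the lower bound `n/(2|z|)`.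
  have key : (derivative (derivative p)).eval z / (derivative p).eval z
      - (derivative p).eval z / p.eval z
      = (p.roots.map fun a => -(1 / (z - a)) ^ 2).sum / ((derivative p).eval z / p.eval z) := by
    rw [hE]
    field_simp
  rw [key, norm_div, div_le_iff₀ hFpos]
  refine hS.trans ?_
  have : 2 * ‖z‖ / (‖z‖ - 1) ^ 2 * (p.natDegree / (2 * ‖z‖))
      = p.natDegree * (1 / (‖z‖ - 1)) ^ 2 := by
    field_simp
  rw [← this]
  gcongr

theorem natDegree_iterate_derivative_complex (p : ℂ[X]) (k : ℕ) :
    (derivative^[k] p).natDegree = p.natDegree - k := by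
  induction k with
  | zero => simp
  | succ k ih => rw [Function.iterate_succ_apply', natDegree_derivative, ih]; omega

theorem iterate_derivative_ne_zero (h0 : p ≠ 0) {k : ℕ} (hk : k ≤ p.natDegree) :
    derivative^[k] p ≠ 0 := by
  induction k with
  | zero => simpa using h0
  | succ k ih =>
    rw [Function.iterate_succ_apply']
    intro h
    have h1 := derivative_eq_zero.1 h
    rw [natDegree_iterate_derivative_complex] at h1
    omega

theorem norm_logDeriv_iterate_derivative_sub_le (hp : ∀ a ∈ p.roots, ‖a‖ ≤ 1)
    (hz : 1 < ‖z‖) {k : ℕ} (hk : k ≤ p.natDegree) :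
    ‖(derivative^[k + 1] p).eval z / (derivative^[k] p).eval z
      - (derivative p).eval z / p.eval z‖ ≤ k * (2 * ‖z‖ / (‖z‖ - 1) ^ 2) := by
  induction k with
  | zero => simp
  | succ k ih =>
    have h1 := ih (by omega)
    have h2 := norm_eval_derivative_div_eval_sub_le (z := z) (p := derivative^[k] p)
      (by rw [natDegree_iterate_derivative_complex]; omega)
      (norm_le_one_of_mem_roots_iterate_derivative hp k) hz
    simp only [Function.iterate_succ_apply'] at h1 h2 ⊢
    push_cast
    refine (norm_sub_le_norm_sub_add_norm_sub _ _ _).trans ((add_le_add h2 h1).trans (by linarith))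

theorem norm_eval_iterate_derivative_div_eval_le (h0 : p ≠ 0) (hp : ∀ a ∈ p.roots, ‖a‖ ≤ 1)
    (hz : 1 < ‖z‖) {k : ℕ} (hk : k ≤ p.natDegree) :
    ‖(derivative^[k] p).eval z / p.eval z‖ ≤ (p.natDegree / (‖z‖ - 1)) ^ k := by
  have hpos : 0 < ‖z‖ - 1 := by linarith
  induction k with
  | zero => simp [eval_ne_zero_of_one_lt_norm h0 hp hz]
  | succ k ih =>
    have hq0 := iterate_derivative_ne_zero h0 (k := k) (by omega)
    have hq := norm_le_one_of_mem_roots_iterate_derivative hp k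
    have h1 := norm_eval_derivative_div_eval_le hq0 hq hz
    have h2 := eval_ne_zero_of_one_lt_norm hq0 hq hz
    rw [natDegree_iterate_derivative_complex] at h1
    have h3 : (((p.natDegree - k : ℕ) : ℝ)) / (‖z‖ - 1) ≤ p.natDegree / (‖z‖ - 1) := by
      gcongr; omega
    rw [Function.iterate_succ_apply',
      ← div_mul_div_cancel₀ (b := (derivative^[k] p).eval z) h2, norm_mul, pow_succ']
    gcongr
    · exact h1.trans h3
    · exact ih (by omega)

end Polynomial

/-! ### Roots on the circle: higher derivatives inside the disc -/

theorem roots_polyOfZeros (z : ℕ → ℂ) (n : ℕ) :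
    (polyOfZeros z n).roots = (Multiset.range n).map z := by
  have : polyOfZeros z n = (((Multiset.range n).map z).map fun a => X - C a).prod := by
    rw [polyOfZeros, Multiset.map_map]; rfl
  rw [this, roots_multiset_prod_X_sub_C]

theorem natDegree_polyOfZeros (z : ℕ → ℂ) (n : ℕ) : (polyOfZeros z n).natDegree = n := by
  simp [polyOfZeros]

theorem polyOfZeros_ne_zero (z : ℕ → ℂ) (n : ℕ) : polyOfZeros z n ≠ 0 :=
  (monic_prod_of_monic _ _ fun j _ => monic_X_sub_C (z j)).ne_zero

theorem norm_le_one_of_mem_roots_polyOfZeros {z : ℕ → ℂ} (hz : ∀ j, ‖z j‖ = 1) (n : ℕ) :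
    ∀ a ∈ (polyOfZeros z n).roots, ‖a‖ ≤ 1 := by
  intro a ha
  rw [roots_polyOfZeros, Multiset.mem_map] at ha
  obtain ⟨j, -, rfl⟩ := ha
  exact (hz j).le

theorem eval_polyOfZeros_ne_zero {z : ℕ → ℂ} (hz : ∀ j, ‖z j‖ = 1) (n : ℕ) {w : ℂ}
    (hw : ‖w‖ < 1) : (polyOfZeros z n).eval w ≠ 0 := by
  rw [polyOfZeros, eval_prod, Finset.prod_ne_zero_iff]
  intro j _ h
  rw [eval_sub, eval_X, eval_C, sub_eq_zero] at h
  rw [h, hz j] at hw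
  exact lt_irrefl _ hw

theorem eval_derivative_div_eval_polyOfZeros (z : ℕ → ℂ) (n : ℕ) {w : ℂ}
    (hw : (polyOfZeros z n).eval w ≠ 0) :
    (derivative (polyOfZeros z n)).eval w / (polyOfZeros z n).eval w
      = ∑ j ∈ Finset.range n, 1 / (w - z j) := by
  rw [eval_derivative_div_eval hw, roots_polyOfZeros, Multiset.map_map]
  rfl

/-- The `j`-th derivative of `(w - z₀) ⋯ (w - zₙ₋₁)`, divided by `n ^ j` and by the product. -/
noncomputable def normalizedDeriv (z : ℕ → ℂ) (n j : ℕ) (w : ℂ) : ℂ :=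
  (derivative^[j] (polyOfZeros z n)).eval w / ((n : ℂ) ^ j * (polyOfZeros z n).eval w)

theorem normalizedDeriv_one (z : ℕ → ℂ) (n : ℕ) {w : ℂ}
    (hw : (polyOfZeros z n).eval w ≠ 0) :
    normalizedDeriv z n 1 w = (n : ℂ)⁻¹ * ∑ j ∈ Finset.range n, 1 / (w - z j) := by
  rw [← eval_derivative_div_eval_polyOfZeros z n hw, normalizedDeriv]
  simp only [Function.iterate_one, pow_one]
  rw [mul_comm (n : ℂ), ← div_div, div_eq_inv_mul _ (n : ℂ)]

section
variable {z : ℕ → ℂ}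

theorem hasDerivAt_normalizedDeriv (hz : ∀ j, ‖z j‖ = 1) {n : ℕ} (hn : n ≠ 0) (j : ℕ) {w : ℂ}
    (hw : ‖w‖ < 1) :
    HasDerivAt (normalizedDeriv z n j)
      (n * (normalizedDeriv z n (j + 1) w
        - normalizedDeriv z n j w * normalizedDeriv z n 1 w)) w := by
  have hne := eval_polyOfZeros_ne_zero hz n hw
  have hn' : (n : ℂ) ≠ 0 := by exact_mod_cast hn
  have h := ((derivative^[j] (polyOfZeros z n)).hasDerivAt w).div
    (((polyOfZeros z n).hasDerivAt w).const_mul ((n : ℂ) ^ j))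
    (mul_ne_zero (pow_ne_zero j hn') hne)
  refine h.congr_deriv ?_
  simp only [normalizedDeriv, Function.iterate_succ_apply', Function.iterate_zero, id]
  field_simp
  ring

theorem norm_normalizedDeriv_one_le (hz : ∀ j, ‖z j‖ = 1) (n : ℕ) {r : ℝ} (hr : r < 1) {w : ℂ}
    (hw : ‖w‖ ≤ r) : ‖normalizedDeriv z n 1 w‖ ≤ 1 / (1 - r) := by
  rw [normalizedDeriv_one z n (eval_polyOfZeros_ne_zero hz n (by linarith)), norm_mul, norm_inv,
    Complex.norm_natCast]
  have h1 : ‖∑ j ∈ Finset.range n, 1 / (w - z j)‖ ≤ n * (1 / (1 - r)) := by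
    have := norm_sum_le_of_le (Finset.range n) (f := fun j => 1 / (w - z j))
      (n := fun _ => 1 / (1 - r)) fun j _ => by
        rw [norm_div, norm_one]
        have := norm_sub_norm_le (z j) w
        rw [hz j, norm_sub_rev] at this
        exact one_div_le_one_div_of_le (by linarith) (by linarith)
    simpa using this
  have h2 : 0 ≤ 1 / (1 - r) := by apply div_nonneg <;> linarith
  rcases Nat.eq_zero_or_pos n with rfl | hn
  · simpa using h2
  · have : (0 : ℝ) < n := by exact_mod_cast hn
    rw [inv_mul_le_iff₀ this]
    exact h1

theorem norm_deriv_normalizedDeriv_le (hz : ∀ j, ‖z j‖ = 1) {n : ℕ} (hn : n ≠ 0) (j : ℕ) {r s C : ℝ}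
    (hrs : r < s) (hs : s < 1) (hC : ∀ w, ‖w‖ ≤ s → ‖normalizedDeriv z n j w‖ ≤ C) {w : ℂ}
    (hw : ‖w‖ ≤ r) : ‖deriv (normalizedDeriv z n j) w‖ ≤ C / (s - r) := by
  have hball : ∀ x ∈ Metric.closedBall w (s - r), ‖x‖ ≤ s := fun x hx => by
    rw [Metric.mem_closedBall, dist_eq_norm] at hx
    have := norm_sub_norm_le x w
    linarith
  refine Complex.norm_deriv_le_of_forall_mem_sphere_norm_le (by linarith) ?_
    fun x hx => hC x (hball x (Metric.sphere_subset_closedBall hx))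
  refine DifferentiableOn.diffContOnCl_ball (U := Metric.closedBall w (s - r)) (fun x hx => ?_)
    subset_rfl
  exact (hasDerivAt_normalizedDeriv hz hn j
    ((hball x hx).trans_lt hs)).differentiableAt.differentiableWithinAt

/-- The recursion `D_(j+1) = D_j'/n + D_j D_1` behind both the bounds and the limits. -/
theorem normalizedDeriv_succ (hz : ∀ j, ‖z j‖ = 1) {n : ℕ} (hn : n ≠ 0) (j : ℕ) {w : ℂ}
    (hw : ‖w‖ < 1) :
    normalizedDeriv z n (j + 1) w = (n : ℂ)⁻¹ * deriv (normalizedDeriv z n j) w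
      + normalizedDeriv z n j w * normalizedDeriv z n 1 w := by
  have hn' : (n : ℂ) ≠ 0 := by exact_mod_cast hn
  rw [(hasDerivAt_normalizedDeriv hz hn j hw).deriv, inv_mul_cancel_left₀ hn', sub_add_cancel]

theorem exists_norm_normalizedDeriv_le (hz : ∀ j, ‖z j‖ = 1) (j : ℕ) {r : ℝ} (hr : r < 1) :
    ∃ C, ∀ n, n ≠ 0 → ∀ w, ‖w‖ ≤ r → ‖normalizedDeriv z n j w‖ ≤ C := by
  induction j generalizing r with
  | zero =>
    refine ⟨1, fun n _ w hw => ?_⟩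
    simp [normalizedDeriv, eval_polyOfZeros_ne_zero hz n (hw.trans_lt hr)]
  | succ j ih =>
    -- Cauchy's estimate for the derivative costs a little radius, so the induction runs over all `r
    -- < 1`.
    obtain ⟨s, hrs, hs⟩ := exists_between hr
    obtain ⟨C, hC⟩ := ih hs
    refine ⟨C / (s - r) + C * (1 / (1 - s)), fun n hn w hw => ?_⟩
    have h1 := norm_deriv_normalizedDeriv_le hz hn j hrs hs (hC n hn) hw
    have h2 := hC n hn w (by linarith)
    have h3 := norm_normalizedDeriv_one_le hz n hs (hw.trans hrs.le)
    rw [normalizedDeriv_succ hz hn j (hw.trans_lt hr)]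
    refine (norm_add_le _ _).trans (add_le_add ?_ ?_)
    · rw [norm_mul, norm_inv, Complex.norm_natCast]
      refine (mul_le_of_le_one_left (norm_nonneg _) (Nat.cast_inv_le_one n)).trans h1
    · rw [norm_mul]
      exact mul_le_mul h2 h3 (norm_nonneg _) ((norm_nonneg _).trans h2)

/-- In the recursion the derivative term is `O(1/n)`, leaving a factor `c` at each step. -/
theorem tendsto_normalizedDeriv (hz : ∀ j, ‖z j‖ = 1) {w : ℂ} (hw : ‖w‖ < 1) {c : ℂ}
    (hc : Tendsto (fun n => normalizedDeriv z n 1 w) atTop (𝓝 c)) (j : ℕ) :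
    Tendsto (fun n => normalizedDeriv z n j w) atTop (𝓝 (c ^ j)) := by
  induction j with
  | zero =>
    refine tendsto_const_nhds.congr fun n => ?_
    simp [normalizedDeriv, eval_polyOfZeros_ne_zero hz n hw]
  | succ j ih =>
    obtain ⟨s, hrs, hs⟩ := exists_between hw
    obtain ⟨C, hC⟩ := exists_norm_normalizedDeriv_le hz j hs
    have h0 : Tendsto (fun n : ℕ => (n : ℂ)⁻¹ * deriv (normalizedDeriv z n j) w) atTop (𝓝 0) := by
      have : Tendsto (fun n : ℕ => (n : ℝ)⁻¹ * (C / (s - ‖w‖))) atTop (𝓝 0) := by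
        simpa using (tendsto_inv_atTop_nhds_zero_nat (𝕜 := ℝ)).mul_const (C / (s - ‖w‖))
      refine squeeze_zero_norm' ?_ this
      filter_upwards [eventually_ne_atTop 0] with n hn
      rw [norm_mul, norm_inv, Complex.norm_natCast]
      gcongr
      exact norm_deriv_normalizedDeriv_le hz hn j hrs hs (hC n hn) le_rfl
    have h1 := h0.add (ih.mul hc)
    rw [zero_add, ← pow_succ] at h1
    refine h1.congr' ?_
    filter_upwards [eventually_ne_atTop 0] with n hn
    rw [normalizedDeriv_succ hz hn j hw]

end

/-! ### A Jensen-type bound for the defects of roots -/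

/-- Rests on `|1 - conj w a|^2 - |w-a|^2 = (1-|w|^2)(1-|a|^2)` and `1 - t^2 ≤ -2 log t`. The `8` is
this `2` times the bound `4` for `|1 - conj w a|^2`. -/
theorem one_sub_normSq_le_log {a w : ℂ} (ha : ‖a‖ ≤ 1) (hw : ‖w‖ < 1) (h : w ≠ a) :
    1 - ‖a‖ ^ 2 ≤ 8 / (1 - ‖w‖ ^ 2) *
      Real.log (‖1 - starRingEnd ℂ w * a‖ / ‖w - a‖) := by
  have hw2 : 0 < 1 - ‖w‖ ^ 2 := by nlinarith [norm_nonneg w]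
  have ha2 : 0 ≤ 1 - ‖a‖ ^ 2 := by nlinarith [norm_nonneg a]
  have hd : 0 < ‖w - a‖ := norm_pos_iff.2 (sub_ne_zero.2 h)
  have hid : ‖1 - starRingEnd ℂ w * a‖ ^ 2 - ‖w - a‖ ^ 2 = (1 - ‖w‖ ^ 2) * (1 - ‖a‖ ^ 2) := by
    simp only [← Complex.normSq_eq_norm_sq, Complex.normSq_apply, Complex.sub_re, Complex.sub_im,
      Complex.mul_re, Complex.mul_im, Complex.conj_re, Complex.conj_im, Complex.one_re,
      Complex.one_im]
    ring
  have hwa : ‖starRingEnd ℂ w * a‖ < 1 := by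
    rw [norm_mul, RCLike.norm_conj]
    nlinarith [norm_nonneg w, norm_nonneg a]
  set b := ‖1 - starRingEnd ℂ w * a‖
  have hb : 0 < b := by
    have := norm_sub_norm_le (1 : ℂ) (starRingEnd ℂ w * a)
    rw [norm_one] at this
    linarith
  have hb2 : b ≤ 2 := by
    have := norm_sub_le (1 : ℂ) (starRingEnd ℂ w * a)
    rw [norm_one] at this
    linarith
  have hlog : 1 - (‖w - a‖ / b) ^ 2 ≤ 2 * Real.log (b / ‖w - a‖) := by
    have h1 := Real.log_le_sub_one_of_pos (x := (‖w - a‖ / b) ^ 2) (by positivity)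
    rw [Real.log_pow, ← inv_div, Real.log_inv] at h1
    rw [inv_div] at h1
    push_cast at h1
    linarith
  have h1 : 1 - (‖w - a‖ / b) ^ 2 = (1 - ‖w‖ ^ 2) * (1 - ‖a‖ ^ 2) / b ^ 2 := by
    rw [← hid]; field_simp
  rw [h1, div_le_iff₀ (by positivity)] at hlog
  have hlog0 : 0 ≤ Real.log (b / ‖w - a‖) := by
    refine Real.log_nonneg ((one_le_div hd).2 ?_)
    refine (sq_le_sq₀ hd.le hb.le).1 ?_
    nlinarith
  rw [div_mul_eq_mul_div, le_div_iff₀ hw2]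
  have hb4 : b ^ 2 ≤ 4 := by nlinarith
  have := mul_le_mul_of_nonneg_left hb4 hlog0
  linarith

theorem sum_one_sub_normSq_le_log (s : Multiset ℂ) {w : ℂ} (hs : ∀ a ∈ s, ‖a‖ ≤ 1) (hw : ‖w‖ < 1)
    (h : ∀ a ∈ s, w ≠ a) :
    0 < (s.map fun a => ‖1 - starRingEnd ℂ w * a‖ / ‖w - a‖).prod ∧
    (s.map fun a => 1 - ‖a‖ ^ 2).sum ≤ 8 / (1 - ‖w‖ ^ 2) *
      Real.log (s.map fun a => ‖1 - starRingEnd ℂ w * a‖ / ‖w - a‖).prod := by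
  induction s using Multiset.induction_on with
  | empty => simp
  | cons a s ih =>
    obtain ⟨i1, i2⟩ := ih (fun b hb => hs b (by simp [hb])) fun b hb => h b (by simp [hb])
    have ha := hs a (by simp)
    have h1 := one_sub_normSq_le_log ha hw (h a (by simp))
    have hd : 0 < ‖w - a‖ := norm_pos_iff.2 (sub_ne_zero.2 (h a (by simp)))
    have hn : 0 < ‖1 - starRingEnd ℂ w * a‖ := by
      have h2 : ‖starRingEnd ℂ w * a‖ < 1 := by
        rw [norm_mul, RCLike.norm_conj]
        nlinarith [norm_nonneg w, norm_nonneg a]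
      have := norm_sub_norm_le (1 : ℂ) (starRingEnd ℂ w * a)
      rw [norm_one] at this
      linarith
    simp only [Multiset.map_cons, Multiset.sum_cons, Multiset.prod_cons]
    refine ⟨by positivity, ?_⟩
    rw [Real.log_mul (by positivity) i1.ne', mul_add]
    exact add_le_add h1 i2

theorem norm_eval_eq_prod_roots (q : ℂ[X]) (w : ℂ) :
    ‖q.eval w‖ = ‖q.leadingCoeff‖ * (q.roots.map fun a => ‖w - a‖).prod := by
  conv_lhs => rw [(IsAlgClosed.splits q).eq_prod_roots]
  rw [eval_mul, eval_C, norm_mul, eval_multiset_prod, Multiset.map_map]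
  congr 1
  rw [show ∀ s : Multiset ℂ, ‖s.prod‖ = (s.map fun a => ‖a‖).prod from
    fun s => map_multiset_prod (normHom : ℂ →*₀ ℝ) s, Multiset.map_map]
  simp

theorem norm_one_sub_conj_mul {w : ℂ} (hw : w ≠ 0) (a : ℂ) :
    ‖1 - starRingEnd ℂ w * a‖ = ‖w‖ * ‖(starRingEnd ℂ w)⁻¹ - a‖ := by
  have hw' : starRingEnd ℂ w ≠ 0 := by simpa using hw
  rw [← RCLike.norm_conj w, ← norm_mul, mul_sub, mul_inv_cancel₀ hw']

/-- Jensen's inequality in disguise: the defects `1 - ‖a‖ ^ 2` of the roots `a` of a polynomial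
in the closed unit disc are controlled by its values at a point and at the reflected point. -/
theorem sum_roots_one_sub_normSq_le {q : ℂ[X]} (hq : ∀ a ∈ q.roots, ‖a‖ ≤ 1) {w : ℂ} (hw0 : w ≠ 0)
    (hw : ‖w‖ < 1) (h : q.eval w ≠ 0) :
    (q.roots.map fun a => 1 - ‖a‖ ^ 2).sum ≤ 8 / (1 - ‖w‖ ^ 2) *
      Real.log (‖w‖ ^ q.natDegree * ‖q.eval (starRingEnd ℂ w)⁻¹‖ / ‖q.eval w‖) := by
  have hq0 : q ≠ 0 := by rintro rfl; simp at h
  refine (sum_one_sub_normSq_le_log q.roots hq hw fun a ha hwa => h ?_).2.trans_eq ?_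
  · rw [hwa]; exact isRoot_of_mem_roots ha
  -- The leading coefficient cancels, and each factor `|1 - conj w a|` equals `|w|` times the
  -- distance from `a` to the reflected point.
  · congr 2
    rw [norm_eval_eq_prod_roots, norm_eval_eq_prod_roots, Multiset.prod_map_div,
      mul_left_comm, mul_div_mul_left _ _ (by simpa using hq0)]
    congr 1
    simp_rw [norm_one_sub_conj_mul hw0]
    rw [Multiset.prod_map_mul, Multiset.map_const', Multiset.prod_replicate, card_roots_complex]

/-! ### Empirical measures and the uniform measure -/

section
variable {E : Type*} [NormedAddCommGroup E] [NormedSpace ℝ E] [CompleteSpace E]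

theorem integrable_and_integral_sum_dirac (s : Multiset ℂ) (f : ℂ → E) :
    Integrable f (s.map Measure.dirac).sum ∧
      ∫ z, f z ∂(s.map Measure.dirac).sum = (s.map f).sum := by
  induction s using Multiset.induction_on with
  | empty => simp
  | cons a s ih =>
    have h : Integrable f (Measure.dirac a) := integrable_dirac (by simp)
    simp only [Multiset.map_cons, Multiset.sum_cons]
    exact ⟨h.add_measure ih.1, by rw [integral_add_measure h ih.1, integral_dirac, ih.2]⟩

theorem integral_empiricalMeasure (s : Multiset ℂ) (f : ℂ → E) :
    ∫ z, f z ∂(empiricalMeasure s) = (s.card : ℝ)⁻¹ • (s.map f).sum := by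
  rw [empiricalMeasure, integral_smul_measure, (integrable_and_integral_sum_dirac s f).2,
    ENNReal.toReal_inv, ENNReal.toReal_natCast]

end

theorem ae_empiricalMeasure {s : Multiset ℂ} {p : ℂ → Prop} (h : ∀ a ∈ s, p a) :
    ∀ᵐ z ∂(empiricalMeasure s), p z := by
  refine Measure.ae_smul_measure ?_ _
  induction s using Multiset.induction_on with
  | empty => simp
  | cons a s ih =>
    simp only [Multiset.map_cons, Multiset.sum_cons]
    rw [ae_add_measure_iff, ae_dirac_eq]
    exact ⟨h a (by simp), ih fun b hb => h b (by simp [hb])⟩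

theorem uniformCircle_ae_norm : ∀ᵐ z ∂(uniformCircle : Measure ℂ), ‖z‖ = 1 := by
  have hm : Measurable fun θ : ℝ => Complex.exp (θ * Complex.I) := by fun_prop
  have hs : MeasurableSet {z : ℂ | ‖z‖ = 1} := measurableSet_eq_fun (by fun_prop) (by fun_prop)
  change ∀ᵐ z ∂(Measure.map _ _), ‖z‖ = 1
  rw [ae_map_iff hm.aemeasurable hs]
  exact ae_of_all _ fun θ => Complex.norm_exp_ofReal_mul_I θ

theorem integral_uniformCircle {f : ℂ → ℂ} (hf : Measurable f) :
    ∫ z, f z ∂(uniformCircle : Measure ℂ) = Real.circleAverage f 0 1 := by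
  have hm : Measurable fun θ : ℝ => Complex.exp (θ * Complex.I) := by fun_prop
  change ∫ z, f z ∂(Measure.map _ _) = _
  rw [integral_map hm.aemeasurable hf.aestronglyMeasurable, integral_smul_measure,
    Real.circleAverage_def, intervalIntegral.integral_of_le (by positivity), ENNReal.toReal_inv,
    ENNReal.toReal_ofReal (by positivity)]
  simp [circleMap]

/-- The Cauchy transform of a measure on the unit circle other than the uniform one does not
vanish identically inside the circle. -/
theorem exists_integral_one_div_sub_ne_zero {μ : ProbabilityMeasure ℂ}
    (hμ : ∀ᵐ z ∂(μ : Measure ℂ), ‖z‖ = 1) (hne : μ ≠ uniformCircle) :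
    ∃ w : ℂ, w ≠ 0 ∧ ‖w‖ < 1 ∧ ∫ a, 1 / (w - a) ∂(μ : Measure ℂ) ≠ 0 := by
  by_contra! H
  -- If the transform vanishes in the punctured disc, the convergence criterion applied to the
  -- constant sequence `uniformCircle` makes it converge to `μ`.
  refine hne (tendsto_nhds_unique (f := fun _ : ℕ => uniformCircle) (l := atTop) ?_
    tendsto_const_nhds)
  refine tendsto_of_tendsto_cauchyTransform
    (fun _ => uniformCircle_ae_norm.mono fun z hz => hz.le) hμ ?_ fun j => ?_
  · have : ∫ z, (1 - ‖z‖ ^ 2) ∂(uniformCircle : Measure ℂ) = 0 :=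
      integral_eq_zero_of_ae (uniformCircle_ae_norm.mono fun z hz => by simp [hz])
    rw [this]
    exact tendsto_const_nhds
  · set x : ℂ := (j : ℂ) + 2
    have hx : ‖x‖ = j + 2 := norm_natCast_add_two j
    have hj : (0 : ℝ) ≤ j := j.cast_nonneg
    have hx0 : x ≠ 0 := norm_pos_iff.1 (by rw [hx]; positivity)
    have hxa : ∀ a : ℂ, ‖a‖ ≤ 1 → x - a ≠ 0 := fun a ha h => by
      rw [← sub_eq_zero.1 h, hx] at ha; linarith
    have e1 : ∫ z, 1 / (x - z) ∂(uniformCircle : Measure ℂ) = 1 / x := by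
      rw [integral_uniformCircle (by fun_prop)]
      have : DiffContOnCl ℂ (fun z : ℂ => 1 / (x - z)) (Metric.ball 0 |(1 : ℝ)|) := by
        refine DifferentiableOn.diffContOnCl_ball (U := Metric.closedBall 0 |(1 : ℝ)|)
          (fun z hz => ?_) subset_rfl
        have hz' : ‖z‖ ≤ 1 := by simpa using hz
        have := hxa z hz'
        exact (DifferentiableAt.div (by fun_prop) (by fun_prop) this).differentiableWithinAt
      -- Mean value property: the average is the value at the centre.
      rw [this.circleAverage, sub_zero]
    have e2 : ∫ z, 1 / (x - z) ∂(μ : Measure ℂ) = 1 / x := by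
      have hw1 : ‖x⁻¹‖ < 1 := by
        rw [norm_inv, hx]; exact inv_lt_one_of_one_lt₀ (by linarith)
      have h0 := H x⁻¹ (inv_ne_zero hx0) hw1
      have hconj : starRingEnd ℂ x = x := by simp [x, map_ofNat]
      -- On the circle `conj a = a⁻¹`, which expresses the kernel at the exterior point `x` through
      -- the kernel at `x⁻¹`, whose integral vanishes.
      have hcongr : ∫ z, 1 / (x - z) ∂(μ : Measure ℂ)
          = ∫ z, (1 / x - (1 / x ^ 2) * starRingEnd ℂ (1 / (x⁻¹ - z))) ∂(μ : Measure ℂ) := by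
        refine integral_congr_ae (hμ.mono fun a ha => ?_)
        have ha0 : a ≠ 0 := norm_pos_iff.1 (by rw [ha]; exact one_pos)
        have hca : starRingEnd ℂ a = a⁻¹ := by
          rw [Complex.inv_def, Complex.normSq_eq_norm_sq, ha]; simp
        have h1 := hxa a ha.le
        have h2 : a - x ≠ 0 := by rw [← neg_ne_zero, neg_sub]; exact h1
        have h3 : x⁻¹ - a⁻¹ ≠ 0 := by
          rw [inv_sub_inv hx0 ha0]
          exact div_ne_zero h2 (mul_ne_zero hx0 ha0)
        simp only [map_div₀, map_one, map_sub, map_inv₀, hconj, hca]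
        rw [inv_sub_inv hx0 ha0]
        field_simp
        ring
      have hint : Integrable (fun z => 1 / (x⁻¹ - z)) (μ : Measure ℂ) := by
        refine Integrable.of_bound
          (by fun_prop : Measurable fun z => 1 / (x⁻¹ - z)).aestronglyMeasurable
          (1 / (1 - ‖x⁻¹‖)) (hμ.mono fun a ha => ?_)
        rw [norm_div, norm_one]
        have := norm_sub_norm_le a x⁻¹
        rw [ha, norm_sub_rev] at this
        exact one_div_le_one_div_of_le (by linarith) this
      have hint' : Integrable (fun z => starRingEnd ℂ (1 / (x⁻¹ - z))) (μ : Measure ℂ) :=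
        (LinearIsometryEquiv.integrable_comp_iff Complex.conjLIE).2 hint
      rw [hcongr, integral_sub (integrable_const _) (hint'.const_mul _), integral_const_mul,
        integral_conj, h0]
      simp
    rw [e1, e2]
    exact tendsto_const_nhds

/-! ### The deterministic convergence theorem -/

section
variable {z : ℕ → ℂ}

theorem norm_eval_polyOfZeros_reflect (hz : ∀ j, ‖z j‖ = 1) (n : ℕ) {w : ℂ} (hw : w ≠ 0) :
    ‖(polyOfZeros z n).eval w‖ = ‖w‖ ^ n * ‖(polyOfZeros z n).eval (starRingEnd ℂ w)⁻¹‖ := by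
  simp only [polyOfZeros, eval_prod, eval_sub, eval_X, eval_C, norm_prod]
  have h : ∀ j, ‖w - z j‖ = ‖w‖ * ‖(starRingEnd ℂ w)⁻¹ - z j‖ := fun j => by
    rw [← norm_one_sub_conj_mul hw]
    have : 1 - starRingEnd ℂ w * z j = -(starRingEnd ℂ (w - z j) * z j) := by
      have h1 : starRingEnd ℂ (z j) * z j = 1 := by
        rw [Complex.conj_mul', hz j]; simp
      rw [map_sub, sub_mul, h1]; ring
    rw [this, norm_neg, norm_mul, hz j, RCLike.norm_conj, mul_one]
  simp_rw [h, Finset.prod_mul_distrib, Finset.prod_const, Finset.card_range]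

theorem exists_eventually_sum_one_sub_normSq_le (hz : ∀ j, ‖z j‖ = 1) {w c : ℂ} (hw0 : w ≠ 0)
    (hw : ‖w‖ < 1) (hc : c ≠ 0)
    (hlim : Tendsto (fun n => normalizedDeriv z n 1 w) atTop (𝓝 c)) (k : ℕ) :
    ∃ C, ∀ᶠ n in atTop, ((derivZeros z k n).map fun a => 1 - ‖a‖ ^ 2).sum ≤ C := by
  set u := (starRingEnd ℂ w)⁻¹ with hu_def
  have hwpos : 0 < ‖w‖ := norm_pos_iff.2 hw0
  have hu : 1 < ‖u‖ := by
    rw [hu_def, norm_inv, RCLike.norm_conj]; exact (one_lt_inv₀ hwpos).2 hw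
  have hupos : 0 < ‖u‖ - 1 := by linarith
  have hcpos : 0 < ‖c‖ := norm_pos_iff.2 hc
  -- In the ratio `n^k` and `|P_n u|` cancel: `|w|^(n-k)/|w|^n` leaves `|w|^(-k)`, the bound at `u`
  -- leaves `(|u|-1)^(-k)`, and the lower bound `|c|^k/2` at `w` leaves the rest.
  set M := 2 / (‖w‖ ^ k * (‖u‖ - 1) ^ k * ‖c‖ ^ k)
  refine ⟨8 / (1 - ‖w‖ ^ 2) * Real.log M, ?_⟩
  have hA : ∀ᶠ n in atTop, ‖c‖ ^ k / 2 < ‖normalizedDeriv z n k w‖ := by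
    have h := (tendsto_normalizedDeriv hz hw hlim k).norm
    rw [norm_pow] at h
    exact h.eventually_const_lt (half_lt_self (by positivity))
  filter_upwards [hA, eventually_ge_atTop (k + 1)] with n hn hkn
  have hroots := norm_le_one_of_mem_roots_polyOfZeros hz n
  have hP0 := polyOfZeros_ne_zero z n
  have hPw : 0 < ‖(polyOfZeros z n).eval w‖ :=
    norm_pos_iff.2 (eval_polyOfZeros_ne_zero hz n hw)
  have hPu : 0 < ‖(polyOfZeros z n).eval u‖ :=
    norm_pos_iff.2 (eval_ne_zero_of_one_lt_norm hP0 hroots hu)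
  have hdeg := natDegree_polyOfZeros z n
  set q := derivative^[k] (polyOfZeros z n) with hq
  have hqroots := norm_le_one_of_mem_roots_iterate_derivative hroots k
  have hq0 : q ≠ 0 := iterate_derivative_ne_zero hP0 (by omega)
  have hqu : 0 < ‖q.eval u‖ := norm_pos_iff.2 (eval_ne_zero_of_one_lt_norm hq0 hqroots hu)
  have hnpos : (0 : ℝ) < n := by exact_mod_cast (by omega : 0 < n)
  have hqw_eq : ‖q.eval w‖
      = ‖normalizedDeriv z n k w‖ * (n ^ k * ‖(polyOfZeros z n).eval w‖) := by
    rw [normalizedDeriv, norm_div, norm_mul, norm_pow, Complex.norm_natCast,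
      div_mul_cancel₀ _ (by positivity)]
  have hqw : 0 < ‖q.eval w‖ := by
    rw [hqw_eq]
    exact mul_pos (lt_trans (by positivity) hn) (by positivity)
  have h1 := sum_roots_one_sub_normSq_le hqroots hw0 hw (norm_pos_iff.1 hqw)
  have h2 := norm_eval_iterate_derivative_div_eval_le hP0 hroots hu (k := k) (by omega)
  rw [hdeg, norm_div, div_le_iff₀ hPu, div_pow, ← hq] at h2
  have hqdeg : q.natDegree = n - k := by rw [hq, natDegree_iterate_derivative_complex, hdeg]
  have hR : ‖w‖ ^ q.natDegree * ‖q.eval u‖ / ‖q.eval w‖ ≤ M := by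
    rw [div_le_iff₀ hqw, hqdeg, hqw_eq, norm_eval_polyOfZeros_reflect hz n hw0]
    have hsplit : ‖w‖ ^ n = ‖w‖ ^ (n - k) * ‖w‖ ^ k := by
      rw [← pow_add, Nat.sub_add_cancel (by omega)]
    calc ‖w‖ ^ (n - k) * ‖q.eval u‖
        ≤ ‖w‖ ^ (n - k) * (n ^ k / (‖u‖ - 1) ^ k * ‖(polyOfZeros z n).eval u‖) := by gcongr
      _ = M * (‖c‖ ^ k / 2 * (n ^ k * (‖w‖ ^ n * ‖(polyOfZeros z n).eval u‖))) := by
        rw [hsplit]; simp only [M]; field_simp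
      _ ≤ _ := by gcongr
  have hRpos : 0 < ‖w‖ ^ q.natDegree * ‖q.eval u‖ / ‖q.eval w‖ := by positivity
  have hK : 0 ≤ 8 / (1 - ‖w‖ ^ 2) := div_nonneg (by norm_num) (by nlinarith)
  exact h1.trans (mul_le_mul_of_nonneg_left (Real.log_le_log hRpos hR) hK)

theorem tendsto_logDeriv_iterate_derivative (hz : ∀ j, ‖z j‖ = 1) {x c : ℂ} (hx : 1 < ‖x‖)
    (hlim : Tendsto (fun n : ℕ => (n : ℂ)⁻¹ * ∑ j ∈ Finset.range n, 1 / (x - z j)) atTop (𝓝 c))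
    (k : ℕ) :
    Tendsto (fun m : ℕ => ((m : ℂ) + 1)⁻¹ *
      ((derivZeros z k (k + 1 + m)).map fun a => 1 / (x - a)).sum) atTop (𝓝 c) := by
  have hcast : ∀ m : ℕ, ((m : ℂ) + 1) ≠ 0 := fun m => Nat.cast_add_one_ne_zero m
  have hinv : Tendsto (fun m : ℕ => 1 / ((m : ℂ) + 1)) atTop (𝓝 0) :=
    tendsto_one_div_add_atTop_nhds_zero_nat
  have hinvR : Tendsto (fun m : ℕ => 1 / ((m : ℝ) + 1)) atTop (𝓝 0) :=
    tendsto_one_div_add_atTop_nhds_zero_nat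
  have hshift : Tendsto (fun m : ℕ => k + 1 + m) atTop atTop :=
    tendsto_atTop_mono (fun m => Nat.le_add_left m (k + 1)) tendsto_id
  -- With `n = k+1+m` this is `n/(m+1)`, correcting for the `n - k = m+1` remaining zeros.
  have hratio : Tendsto (fun m : ℕ => 1 + (k : ℂ) * (1 / ((m : ℂ) + 1))) atTop (𝓝 1) := by
    simpa using (hinv.const_mul (k : ℂ)).const_add 1
  have h1 := hratio.mul (hlim.comp hshift)
  rw [one_mul] at h1
  have h2 : Tendsto (fun m : ℕ => ((m : ℂ) + 1)⁻¹ *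
      (((derivZeros z k (k + 1 + m)).map fun a => 1 / (x - a)).sum
        - ∑ j ∈ Finset.range (k + 1 + m), 1 / (x - z j))) atTop (𝓝 0) := by
    have hb := hinvR.mul_const (k * (2 * ‖x‖ / (‖x‖ - 1) ^ 2))
    rw [zero_mul] at hb
    refine squeeze_zero_norm (fun m => ?_) hb
    set n := k + 1 + m
    have hroots := norm_le_one_of_mem_roots_polyOfZeros hz n
    have hP0 := polyOfZeros_ne_zero z n
    have hdeg := natDegree_polyOfZeros z n
    have hk : k ≤ (polyOfZeros z n).natDegree := by omega
    have hq := eval_ne_zero_of_one_lt_norm (iterate_derivative_ne_zero hP0 hk)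
      (norm_le_one_of_mem_roots_iterate_derivative hroots k) hx
    rw [derivZeros, ← eval_derivative_div_eval hq, ← eval_derivative_div_eval_polyOfZeros z n
      (eval_ne_zero_of_one_lt_norm hP0 hroots hx), norm_mul, norm_inv]
    have hm : ‖((m : ℂ) + 1)‖ = m + 1 := by
      have : ((m : ℂ) + 1) = ((m + 1 : ℕ) : ℂ) := by push_cast; ring
      rw [this, Complex.norm_natCast]; push_cast; ring
    rw [hm, one_div]
    gcongr
    have := norm_logDeriv_iterate_derivative_sub_le hroots hx hk
    rwa [Function.iterate_succ_apply'] at this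
  have h3 := h2.add h1
  rw [zero_add] at h3
  refine h3.congr fun m => ?_
  have hn : ((k + 1 + m : ℕ) : ℂ) ≠ 0 := by exact_mod_cast (by omega : k + 1 + m ≠ 0)
  have hm := hcast m
  simp only [Function.comp]
  have e : (1 + (k : ℂ) * (1 / ((m : ℂ) + 1))) * (((k + 1 + m : ℕ) : ℂ)⁻¹ *
      ∑ j ∈ Finset.range (k + 1 + m), 1 / (x - z j))
      = ((m : ℂ) + 1)⁻¹ * ∑ j ∈ Finset.range (k + 1 + m), 1 / (x - z j) := by
    rw [← mul_assoc]
    congr 1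
    field_simp
    push_cast
    ring
  rw [e]
  ring

theorem tendsto_derivZerosMeasure (hz : ∀ j, ‖z j‖ = 1) {μ : ProbabilityMeasure ℂ}
    (hμ : ∀ᵐ z ∂(μ : Measure ℂ), ‖z‖ = 1)
    (hout : ∀ i : ℕ, Tendsto (fun n : ℕ => (n : ℂ)⁻¹ *
      ∑ j ∈ Finset.range n, 1 / ((i : ℂ) + 2 - z j)) atTop
      (𝓝 (∫ a, 1 / ((i : ℂ) + 2 - a) ∂(μ : Measure ℂ))))
    {w c : ℂ} (hw0 : w ≠ 0) (hw : ‖w‖ < 1) (hc : c ≠ 0)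
    (hin : Tendsto (fun n : ℕ => (n : ℂ)⁻¹ * ∑ j ∈ Finset.range n, 1 / (w - z j)) atTop (𝓝 c))
    (k : ℕ) :
    Tendsto (fun m : ℕ => derivZerosMeasure z k (k + 1 + m) (Nat.le_add_right _ _))
      atTop (𝓝 μ) := by
  have hcard : ∀ m : ℕ, (derivZeros z k (k + 1 + m)).card = m + 1 := fun m => by
    rw [card_derivZeros]; omega
  have hdisc : ∀ n, ∀ a ∈ derivZeros z k n, ‖a‖ ≤ 1 := fun n =>
    norm_le_one_of_mem_roots_iterate_derivative (norm_le_one_of_mem_roots_polyOfZeros hz n) k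
  refine tendsto_of_tendsto_cauchyTransform (fun m => ae_empiricalMeasure (hdisc _)) hμ ?_
    fun i => ?_
  · have hin' : Tendsto (fun n => normalizedDeriv z n 1 w) atTop (𝓝 c) :=
      hin.congr fun n => (normalizedDeriv_one z n (eval_polyOfZeros_ne_zero hz n hw)).symm
    obtain ⟨C, hC⟩ := exists_eventually_sum_one_sub_normSq_le hz hw0 hw hc hin' k
    have hshift : Tendsto (fun m : ℕ => k + 1 + m) atTop atTop :=
      tendsto_atTop_mono (fun m => Nat.le_add_left m (k + 1)) tendsto_id
    have hb : Tendsto (fun m : ℕ => 1 / ((m : ℝ) + 1) * C) atTop (𝓝 0) := by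
      simpa using (tendsto_one_div_add_atTop_nhds_zero_nat (𝕜 := ℝ)).mul_const C
    refine squeeze_zero' (Eventually.of_forall fun m => ?_) ?_ hb
    · refine integral_nonneg_of_ae ((ae_empiricalMeasure (hdisc _)).mono fun a ha => ?_)
      have : ‖a‖ ^ 2 ≤ 1 := pow_le_one₀ (norm_nonneg _) ha
      simpa using this
    · filter_upwards [hshift.eventually hC] with m hm
      change ∫ a, (1 - ‖a‖ ^ 2) ∂(empiricalMeasure _) ≤ _
      rw [integral_empiricalMeasure, hcard, smul_eq_mul, one_div]
      push_cast
      gcongr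
  · have hx : 1 < ‖((i : ℂ) + 2)‖ := by
      rw [norm_natCast_add_two]
      linarith [(i.cast_nonneg : (0 : ℝ) ≤ i)]
    refine (tendsto_logDeriv_iterate_derivative hz hx (hout i) k).congr fun m => ?_
    change _ = ∫ a, 1 / ((i : ℂ) + 2 - a) ∂(empiricalMeasure _)
    rw [integral_empiricalMeasure, hcard, Complex.real_smul]
    push_cast
    rfl

end

/-! ### The strong law and the almost sure conclusion -/

/-- The strong law of large numbers for the Cauchy transforms of the empirical measures. -/
theorem ae_tendsto_average_one_div_sub {Ω : Type*} [MeasurableSpace Ω] {P : Measure Ω}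
    [IsProbabilityMeasure P] {μ : ProbabilityMeasure ℂ}
    (hμ : ∀ᵐ z ∂(μ : Measure ℂ), ‖z‖ = 1) {Z : ℕ → Ω → ℂ} (hZ_meas : ∀ j, Measurable (Z j))
    (hZ_indep : iIndepFun Z P) (hZ_law : ∀ j, P.map (Z j) = (μ : Measure ℂ)) {x : ℂ}
    (hx : ‖x‖ ≠ 1) :
    ∀ᵐ ω ∂P, Tendsto (fun n : ℕ => (n : ℂ)⁻¹ * ∑ j ∈ Finset.range n, 1 / (x - Z j ω)) atTop
      (𝓝 (∫ a, 1 / (x - a) ∂(μ : Measure ℂ))) := by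
  have hg : Measurable fun a : ℂ => 1 / (x - a) := by fun_prop
  have hint : Integrable (fun a => 1 / (x - a)) (μ : Measure ℂ) := by
    refine Integrable.of_bound hg.aestronglyMeasurable (1 / |‖x‖ - 1|) (hμ.mono fun a ha => ?_)
    rw [norm_div, norm_one]
    have := abs_norm_sub_norm_le x a
    rw [ha] at this
    exact one_div_le_one_div_of_le (abs_pos.2 (sub_ne_zero.2 hx)) this
  have hint0 : Integrable (fun ω => 1 / (x - Z 0 ω)) P := by
    rw [← hZ_law 0] at hint
    exact hint.comp_measurable (hZ_meas 0)
  have h := strong_law_ae (fun j ω => 1 / (x - Z j ω)) hint0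
    (fun i j hij => (hZ_indep.indepFun hij).comp hg hg)
    (fun j => (IdentDistrib.mk (hZ_meas j).aemeasurable (hZ_meas 0).aemeasurable
      (by rw [hZ_law, hZ_law])).comp hg)
  have hlim : ∫ ω, 1 / (x - Z 0 ω) ∂P = ∫ a, 1 / (x - a) ∂(μ : Measure ℂ) := by
    rw [← hZ_law 0, integral_map (hZ_meas 0).aemeasurable hg.aestronglyMeasurable]
  rw [hlim] at h
  filter_upwards [h] with ω hω
  refine hω.congr fun n => ?_
  rw [Complex.real_smul]
  push_cast
  rfl

theorem corollary4 {Ω : Type*} [MeasurableSpace Ω] (P : Measure Ω) [IsProbabilityMeasure P]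
    (μ : ProbabilityMeasure ℂ)
    (hμ_supp : (μ : Measure ℂ) (Metric.sphere (0 : ℂ) 1) = 1)
    (hμ_nonunif : μ ≠ uniformCircle)
    (Z : ℕ → Ω → ℂ)
    (hZ_meas : ∀ j, Measurable (Z j))
    (hZ_indep : iIndepFun Z P)
    (hZ_law : ∀ j, P.map (Z j) = (μ : Measure ℂ))
    (k : ℕ) (hk : 1 < k) :
    ∀ᵐ ω ∂P,
      Tendsto (fun m : ℕ => derivZerosMeasure (fun j => Z j ω) k (k + 1 + m) (Nat.le_add_right _ _))
        atTop (𝓝 μ) := by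
  have hμ : ∀ᵐ z ∂(μ : Measure ℂ), ‖z‖ = 1 := by
    have := (mem_ae_iff_prob_eq_one Metric.isClosed_sphere.measurableSet).2 hμ_supp
    filter_upwards [this] with z hz
    simpa using hz
  have hZ1 : ∀ᵐ ω ∂P, ∀ j, ‖Z j ω‖ = 1 := by
    rw [ae_all_iff]
    intro j
    rw [← hZ_law j] at hμ
    exact ae_of_ae_map (hZ_meas j).aemeasurable hμ
  obtain ⟨w, hw0, hw, hc⟩ := exists_integral_one_div_sub_ne_zero hμ hμ_nonunif
  have hin := ae_tendsto_average_one_div_sub hμ hZ_meas hZ_indep hZ_law hw.ne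
  -- Only countably many exterior points are needed, so the exceptional sets have null union.
  have hout : ∀ᵐ ω ∂P, ∀ i : ℕ, Tendsto (fun n : ℕ => (n : ℂ)⁻¹ *
      ∑ j ∈ Finset.range n, 1 / ((i : ℂ) + 2 - Z j ω)) atTop
      (𝓝 (∫ a, 1 / ((i : ℂ) + 2 - a) ∂(μ : Measure ℂ))) := by
    rw [ae_all_iff]
    refine fun i => ae_tendsto_average_one_div_sub hμ hZ_meas hZ_indep hZ_law ?_
    rw [norm_natCast_add_two]
    linarith [(i.cast_nonneg : (0 : ℝ) ≤ i)]
  filter_upwards [hZ1, hin, hout] with ω h1 h2 h3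
  exact tendsto_derivZerosMeasure h1 hμ h3 hw0 hw hc h2 k
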